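/- **Proposition (Mixture representation).** Let $D\ge 1$, $\underline\alpha=(\alpha_1,\dots,\alpha_{D+1})$ with all $\alpha_i>0$, $\underline\lambda=(\lambda_1,\dots,\lambda_{D+1})$ with all $\lambda_i\ge 0$, and $\alpha^+=\sum_{i=1}^{D+1}\alpha_i$. Let the pairs $(M_i,Y'_i)$, $i=1,\dots,D+1$, be independent with $M_i\sim\mathrm{Poisson}(\lambda_i/2)$ and $Y'_i\mid M_i\sim\chi^2_{2\alpha_i+2M_i}$, so that the $Y'_i\sim\chi'^{\,2}_{2\alpha_i}(\lambda_i)$ are independent non-central chi-squared variables (with $2\alpha_i$ degrees of freedom and non-centrality $\lambda_i$). Put $\underline M=(M_1,\dots,M_{D+1})$, $Y'^+=\sum_{i=1}^{D+1}Y'_i$ and $\underline X'=(Y'_1/Y'^+,\dots,Y'_D/Y'^+)$. A conditional law given $Y'^+=1$ is understood as the value at $1$ of a regular conditional distribution given $Y'^+$ that is weakly continuous at $1$ (where $1$ lies in the support of the law of $Y'^+$); this value is unique if it exists. Define - $\mathrm{CNcDir}^D(\underline\alpha,\underline\lambda)$ as the conditional law of $\underline X'$ given $Y'^+=1$; - $\mathrm{MW}^{D+1}(\alpha^+,\underline\lambda)$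 as the conditional law of $\underline M$ given $Y'^+=1$ (the same law for all positive shape vectors with the same sum $\alpha^+$); - $\mathrm{Dir}^D(\underline\beta)$, for $\beta_i>0$, as the law of $(Y_1/Y^+,\dots,Y_D/Y^+)$, where the $Y_i\sim\chi^2_{2\beta_i}$, $i=1,\dots,D+1$, are independent and $Y^+=\sum_{i=1}^{D+1} Y_i$. Then the conditional law of $(\underline X',\underline M)$ given $Y'^+=1$ and the laws $\mathrm{CNcDir}^D(\underline\alpha,\underline\lambda)$ and $\mathrm{MW}^{D+1}(\alpha^+,\underline\lambda)$ exist and are unique. If $(\underline X'',\underline N)$ is a random vector whose joint law is the conditional law of $(\underline X',\underline M)$ given $Y'^+=1$, then $\underline X''\sim\mathrm{CNcDir}^D(\underline\alpha,\underline\lambda)$, $\underline N\sim\mathrm{MW}^{D+1}(\alpha^+,\underline\lambda)$, and $$\underline X''\mid\underline N\ \sim\ \mathrm{Dir}^D(\underline\alpha+\underline N),$$ i.e. for almost every $\underline n$ with respect to the law of $\underline N$, the conditional distribution of $\underline X''$ given $\underline N=\underline n$ is $\mathrm{Dir}^D(\underline\alpha+\underline n)$. In particular $$\mathrm{CNcDir}^D(\underline\alpha,\underline\lambda)=\sum_{\underline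 n\in\mathbb N_0^{D+1}}\mathrm{MW}^{D+1}(\alpha^+,\underline\lambda)(\{\underline n\})\;\mathrm{Dir}^D(\underline\alpha+\underline n).$$ -/

import Mathlib

open MeasureTheory ProbabilityTheory Filter Topology
open scoped NNReal ENNReal BoundedContinuousFunction

/-- `ρ` is *the* conditional law of `Z` given `T = t` under `P`: it is the value at `t` of a regular
conditional distribution of `Z` given `T` that is weakly continuous at `t`, where `t` is a point of
the topological support of the law of `T`. Such a value is unique when it exists, see
`IsCondLawAt.unique`. -/
def IsCondLawAt {Ω E : Type*} [MeasurableSpace Ω] [MeasurableSpace E] [TopologicalSpace E]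
    (P : Measure Ω) (Z : Ω → E) (T : Ω → ℝ) (t : ℝ) (ρ : Measure E) : Prop :=
  t ∈ (P.map T).support ∧
  ∃ κ : Kernel ℝ E, IsMarkovKernel κ ∧
    (P.map T) ⊗ₘ κ = P.map (fun ω => (T ω, Z ω)) ∧
    (∀ f : E →ᵇ ℝ, ContinuousAt (fun s => ∫ z, f z ∂(κ s)) t) ∧
    κ t = ρ

theorem IsCondLawAt.unique {Ω E : Type*} [MeasurableSpace Ω] [MeasurableSpace E] [MetricSpace E]
    [SecondCountableTopology E] [BorelSpace E] {P : Measure Ω} [IsFiniteMeasure P]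
    {Z : Ω → E} {T : Ω → ℝ} {t : ℝ} {ρ ρ' : Measure E}
    (h : IsCondLawAt P Z T t ρ) (h' : IsCondLawAt P Z T t ρ') : ρ = ρ' := by
  obtain ⟨ht, κ, hκ, hd, hc, rfl⟩ := h
  obtain ⟨-, η, hη, hd', hc', rfl⟩ := h'
  have hae : κ =ᵐ[P.map T] η := Kernel.ae_eq_of_compProd_eq (hd.trans hd'.symm)
  have hfreq : ∃ᶠ s in 𝓝 t, κ s = η s := by
    intro hn
    have hpos := (Measure.mem_support_iff_forall t).1 ht _ hn
    exact hpos.ne' (ae_iff.1 hae)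
  refine ext_of_forall_integral_eq_of_IsFiniteMeasure fun f => ?_
  by_contra hne
  have hev := ((hc f).prodMk (hc' f)).eventually
    ((isClosed_diagonal (X := ℝ)).isOpen_compl.eventually_mem hne)
  obtain ⟨s, hs, hs'⟩ := (hfreq.and_eventually hev).exists
  exact hs' (by simp [hs])

noncomputable section

/-- The chi-squared distribution with `g > 0` (not necessarily integer) degrees of freedom. -/
def chiSq (g : ℝ) : Measure ℝ := gammaMeasure (g / 2) (1 / 2)

/-- Joint law of `(M, Y')`, where `M ~ Poisson(l / 2)` and `Y' | M ~ χ²_{g + 2 M}`. -/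
def ncChiSqJoint (g : ℝ) (l : ℝ≥0) : Measure (ℕ × ℝ) :=
  (poissonMeasure (l / 2)).bind fun m => (chiSq (g + 2 * m)).map (Prod.mk m)

/-- The non-central chi-squared distribution with `g` degrees of freedom and non-centrality
parameter `l`. -/
def ncChiSq (g : ℝ) (l : ℝ≥0) : Measure ℝ := (ncChiSqJoint g l).map Prod.snd

/-- The first `D` normalized components `(y₁ / y⁺, …, y_D / y⁺)` of `y = (y₁, …, y_{D+1})`. -/
def normalized {D : ℕ} (y : Fin (D + 1) → ℝ) : Fin D → ℝ := fun i => y i.castSucc / ∑ j, y j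

/-- The Dirichlet distribution `Dir^D(α)`: the law of `(Y₁ / Y⁺, …, Y_D / Y⁺)` for independent
`Y_i ~ χ²_{2 α_i}`. -/
def dirichlet {D : ℕ} (α : Fin (D + 1) → ℝ) : Measure (Fin D → ℝ) :=
  (Measure.pi fun i => chiSq (2 * α i)).map normalized

/-- Joint law of `D + 1` independent pairs `(M_i, Y'_i)` with `M_i ~ Poisson(l_i / 2)` and
`Y'_i | M_i ~ χ²_{2 α_i + 2 M_i}`; so `M` is multi-Poisson and the `Y'_i` are independent
non-central chi-squared variables. -/
def pairLaw {D : ℕ} (α : Fin (D + 1) → ℝ) (l : Fin (D + 1) → ℝ≥0) :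
    Measure (Fin (D + 1) → ℕ × ℝ) :=
  Measure.pi fun i => ncChiSqJoint (2 * α i) (l i)

/-- `μ = CNcDir^D(α, l)`: the conditional law of `(Y'₁ / Y'⁺, …, Y'_D / Y'⁺)` given `Y'⁺ = 1`,
for independent non-central chi-squared `Y'_i` with parameters `2 α_i`, `l_i`. -/
def IsCNcDir {D : ℕ} (α : Fin (D + 1) → ℝ) (l : Fin (D + 1) → ℝ≥0)
    (μ : Measure (Fin D → ℝ)) : Prop :=
  IsCondLawAt (Measure.pi fun i => ncChiSq (2 * α i) (l i)) normalized (fun y => ∑ i, y i) 1 μ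

/-- `ν = MW^{D+1}(a, l)`: the conditional law of `M = (M₁, …, M_{D+1})` given `Y'⁺ = 1`, for every
choice of positive shape parameters `β_i` of the `Y'_i` with total `a`. -/
def IsMixtureWeight {D : ℕ} (a : ℝ) (l : Fin (D + 1) → ℝ≥0)
    (ν : Measure (Fin (D + 1) → ℕ)) : Prop :=
  0 < a ∧ ∀ β : Fin (D + 1) → ℝ, (∀ i, 0 < β i) → ∑ i, β i = a →
    IsCondLawAt (pairLaw β l) (fun p i => (p i).1) (fun p => ∑ i, (p i).2) 1 ν

/-- `ρ` is the joint conditional law of `((Y'₁ / Y'⁺, …, Y'_D / Y'⁺), M)` given `Y'⁺ = 1`, i.e. the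
joint law of `(X'', N)`. -/
def IsCNcDirJoint {D : ℕ} (α : Fin (D + 1) → ℝ) (l : Fin (D + 1) → ℝ≥0)
    (ρ : Measure ((Fin D → ℝ) × (Fin (D + 1) → ℕ))) : Prop :=
  IsCondLawAt (pairLaw α l) (fun p => (normalized fun i => (p i).2, fun i => (p i).1))
    (fun p => ∑ i, (p i).2) 1 ρ

end

/-! Given `M = n`, the `Y'_i` are independent gamma variables of shapes `α_i + n_i` with the common
rate `1 / 2`. Hence their sum is gamma of shape `α⁺ + ∑ n_i` and independent of the normalized
vector, which is `Dir(α + n)` (`pi_gammaMeasure_map_sum_normalized`). Conditioning on `Y'⁺ = 1`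
therefore leaves the Dirichlet law untouched and only reweights `n` by Bayes' formula: the Poisson
weights are multiplied by the gamma density at `1` and renormalized. These weights see `α` only
through `α⁺`.

The independence comes from exponential tilting: the weight `exp (t ∑ y_i)` changes the rate from
`r` to `r - t`, which is a rescaling and so invisible to the normalized vector. Exponential
integrals near `0` then determine the law of the sum on each event of the normalized vector.

The posterior is a version weakly continuous at `1` because the gamma densities are continuous there
and bounded near `1` uniformly in `n` (`exists_gammaPDF_add_natCast_le`), so that dominated
convergence applies (`isCondLawAt_posterior`). The other conditional laws are projections of the
joint one, and `IsCondLawAt.unique` gives uniqueness. -/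

/-! ### Measures determined by exponential integrals -/

/-- Finite measures on `ℝ` whose moment generating functions are finite and agree near `0` are
equal. -/
theorem MeasureTheory.Measure.ext_of_mgf_eq_near_zero {μ ν : Measure ℝ} [IsFiniteMeasure μ]
    [IsFiniteMeasure ν] {r : ℝ} (hr : 0 < r)
    (hμ : ∀ t ∈ Set.Ioo (-r) r, Integrable (fun x => Real.exp (t * x)) μ)
    (hν : ∀ t ∈ Set.Ioo (-r) r, Integrable (fun x => Real.exp (t * x)) ν)
    (h : ∀ t ∈ Set.Ioo (-r) r, mgf id μ t = mgf id ν t) : μ = ν := by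
  -- The complex moment generating functions are analytic on this vertical strip and agree at its
  -- real points. The identity theorem carries the equality to the imaginary axis, where they are
  -- the characteristic functions.
  set S : Set ℂ := {z | z.re ∈ Set.Ioo (-r) r} with hS
  have hX : AnalyticOnNhd ℂ (complexMGF id μ) S := analyticOnNhd_complexMGF.mono
    fun z hz => interior_maximal (fun t ht => hμ t ht) isOpen_Ioo hz
  have hY : AnalyticOnNhd ℂ (complexMGF id ν) S := analyticOnNhd_complexMGF.mono
    fun z hz => interior_maximal (fun t ht => hν t ht) isOpen_Ioo hz
  have hconv : IsPreconnected S :=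
    ((convex_Ioo (-r) r).linear_preimage Complex.reLm).isPreconnected
  have h0 : (0 : ℂ) ∈ S := by simp [hS, hr]
  have hfreq : ∃ᶠ z in 𝓝[≠] (0 : ℂ), complexMGF id μ z = complexMGF id ν z := by
    have hev : ∀ᶠ x : ℝ in 𝓝[≠] 0, complexMGF id μ x = complexMGF id ν x := by
      filter_upwards [nhdsWithin_le_nhds (Ioo_mem_nhds (neg_neg_of_pos hr) hr)] with x hx
      rw [complexMGF_ofReal, complexMGF_ofReal, h x hx]
    have htend : Tendsto (fun x : ℝ => (x : ℂ)) (𝓝[≠] 0) (𝓝[≠] 0) := by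
      refine tendsto_nhdsWithin_iff.2 ⟨?_, ?_⟩
      · exact (Complex.continuous_ofReal.tendsto' 0 0 (by simp)).mono_left nhdsWithin_le_nhds
      · filter_upwards [self_mem_nhdsWithin] with x hx
        simpa using hx
    exact htend.frequently hev.frequently
  have heq := hX.eqOn_of_preconnected_of_frequently_eq hY hconv h0 hfreq
  refine Measure.ext_of_charFun (funext fun t => ?_)
  rw [← complexMGF_id_mul_I, ← complexMGF_id_mul_I]
  exact heq (by simp [hS, hr])

/-- Version of `MeasureTheory.Measure.ext_of_mgf_eq_near_zero` for Lebesgue integrals. -/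
theorem MeasureTheory.Measure.ext_of_lintegral_exp_eq {μ ν : Measure ℝ} [IsFiniteMeasure μ]
    [IsFiniteMeasure ν] {r : ℝ} (hr : 0 < r)
    (hν : ∀ t < r, ∫⁻ x, ENNReal.ofReal (Real.exp (t * x)) ∂ν ≠ ∞)
    (h : ∀ t < r, ∫⁻ x, ENNReal.ofReal (Real.exp (t * x)) ∂μ
      = ∫⁻ x, ENNReal.ofReal (Real.exp (t * x)) ∂ν) : μ = ν := by
  have key (ρ : Measure ℝ) (t : ℝ) (ht : ∫⁻ x, ENNReal.ofReal (Real.exp (t * x)) ∂ρ ≠ ∞) :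
      Integrable (fun x => Real.exp (t * x)) ρ := by
    refine ⟨by fun_prop, ?_⟩
    rw [hasFiniteIntegral_iff_ofReal (ae_of_all _ fun x => (Real.exp_pos _).le)]
    exact lt_top_iff_ne_top.2 ht
  refine Measure.ext_of_mgf_eq_near_zero hr (fun t ht => key μ t ?_) (fun t ht => key ν t ?_)
    fun t ht => ?_
  · rw [h t ht.2]; exact hν t ht.2
  · exact hν t ht.2
  · simp only [mgf, id]
    rw [integral_eq_lintegral_of_nonneg_ae (ae_of_all _ fun x => (Real.exp_pos _).le) (by fun_prop),
      integral_eq_lintegral_of_nonneg_ae (ae_of_all _ fun x => (Real.exp_pos _).le) (by fun_prop),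
      h t ht.2]

/-! ### Gamma distributions: tilting, scaling, independence of sum and normalized vector -/

/-- Exponential tilting of a gamma distribution. -/
theorem gammaMeasure_withDensity_exp {a r t : ℝ} (hr : 0 < r) (ht : t < r) :
    (gammaMeasure a r).withDensity (fun x => ENNReal.ofReal (Real.exp (t * x)))
      = ENNReal.ofReal ((r / (r - t)) ^ a) • gammaMeasure a (r - t) := by
  have hrt : 0 < r - t := sub_pos.2 ht
  have hm (a r : ℝ) : Measurable (gammaPDF a r) := (measurable_gammaPDFReal a r).ennreal_ofReal
  rw [gammaMeasure, gammaMeasure, ← withDensity_mul _ (hm _ _) (by fun_prop),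
    ← withDensity_smul _ (hm _ _)]
  congr 1
  ext x
  simp only [Pi.mul_apply, Pi.smul_apply, smul_eq_mul, gammaPDF]
  rw [← ENNReal.ofReal_mul' (Real.exp_pos _).le, ← ENNReal.ofReal_mul (by positivity)]
  congr 1
  unfold gammaPDFReal
  split_ifs with hx
  · rw [Real.div_rpow hr.le hrt.le, show -(r * x) = -((r - t) * x) + -(t * x) by ring, Real.exp_add,
      Real.exp_neg (t * x)]
    have := (Real.rpow_pos_of_pos hrt a).ne'
    have := (Real.exp_pos (t * x)).ne'
    field_simp
  · simp

theorem lintegral_exp_gammaMeasure {a r t : ℝ} (ha : 0 < a) (hr : 0 < r) (ht : t < r) :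
    ∫⁻ x, ENNReal.ofReal (Real.exp (t * x)) ∂(gammaMeasure a r)
      = ENNReal.ofReal ((r / (r - t)) ^ a) := by
  have := isProbabilityMeasure_gammaMeasure ha (sub_pos.2 ht)
  have h := congrArg (· Set.univ) (gammaMeasure_withDensity_exp (a := a) hr ht)
  simpa [withDensity_apply] using h

theorem gammaMeasure_map_mul {a r c : ℝ} (ha : 0 < a) (hr : 0 < r) (hc : 0 < c) :
    (gammaMeasure a r).map (c * ·) = gammaMeasure a (r / c) := by
  have := isProbabilityMeasure_gammaMeasure ha hr
  have := isProbabilityMeasure_gammaMeasure ha (div_pos hr hc)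
  refine Measure.ext_of_lintegral_exp_eq (div_pos hr hc) (fun t ht => ?_) fun t ht => ?_
  · rw [lintegral_exp_gammaMeasure ha (div_pos hr hc) ht]
    exact ENNReal.ofReal_ne_top
  · have ht' : t * c < r := (lt_div_iff₀ hc).1 ht
    have := sub_pos.2 ht
    have := sub_pos.2 ht'
    rw [lintegral_map (by fun_prop) (by fun_prop), lintegral_exp_gammaMeasure ha (div_pos hr hc) ht]
    simp_rw [← mul_assoc]
    rw [lintegral_exp_gammaMeasure ha hr ht']
    congr 2
    field_simp

theorem lintegral_fintype_prod_eq_prod {ι : Type*} [Fintype ι] {E : ι → Type*}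
    [∀ i, MeasurableSpace (E i)] {μ : ∀ i, Measure (E i)} [∀ i, IsProbabilityMeasure (μ i)]
    {f : ∀ i, E i → ℝ≥0∞} (hf : ∀ i, Measurable (f i)) :
    ∫⁻ x, ∏ i, f i (x i) ∂(Measure.pi μ) = ∏ i, ∫⁻ x, f i x ∂(μ i) := by
  have h := lintegral_prod_eq_prod_lintegral_of_indepFun Finset.univ (fun i (x : ∀ i, E i) => f i (x i))
    (iIndepFun_pi (μ := μ) fun i => (hf i).aemeasurable)
    (fun i => (hf i).comp (measurable_pi_apply i))
  rw [h]
  refine Finset.prod_congr rfl fun i _ => ?_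
  exact (measurePreserving_eval μ i).lintegral_comp (hf i)

theorem pi_withDensity_prod {ι : Type*} [Fintype ι] {E : ι → Type*}
    [∀ i, MeasurableSpace (E i)] {μ : ∀ i, Measure (E i)} [∀ i, IsProbabilityMeasure (μ i)]
    {f : ∀ i, E i → ℝ≥0∞} (hf : ∀ i, Measurable (f i))
    [∀ i, SigmaFinite ((μ i).withDensity (f i))] :
    (Measure.pi μ).withDensity (fun x => ∏ i, f i (x i))
      = Measure.pi fun i => (μ i).withDensity (f i) := by
  refine (Measure.pi_eq fun s hs => ?_).symm
  rw [withDensity_apply _ (.univ_pi hs), ← lintegral_indicator (.univ_pi hs)]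
  simp_rw [withDensity_apply _ (hs _), ← lintegral_indicator (hs _)]
  rw [← lintegral_fintype_prod_eq_prod fun i => (hf i).indicator (hs i)]
  refine lintegral_congr fun x => ?_
  by_cases hx : x ∈ Set.univ.pi s
  · rw [Set.indicator_of_mem hx]
    exact Finset.prod_congr rfl fun i _ => (Set.indicator_of_mem (hx i trivial) _).symm
  · rw [Set.indicator_of_notMem hx]
    obtain ⟨i, hi⟩ : ∃ i, x i ∉ s i := by simpa using hx
    exact (Finset.prod_eq_zero (Finset.mem_univ i) (Set.indicator_of_notMem hi _)).symm

theorem pi_smul_measure {ι : Type*} [Fintype ι] {E : ι → Type*}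
    [∀ i, MeasurableSpace (E i)] {μ : ∀ i, Measure (E i)} [∀ i, SigmaFinite (μ i)]
    (c : ι → ℝ≥0∞) [∀ i, SigmaFinite (c i • μ i)] :
    (Measure.pi fun i => c i • μ i) = (∏ i, c i) • Measure.pi μ :=
  Measure.pi_eq fun s _ => by simp [Finset.prod_mul_distrib]

@[fun_prop]
theorem measurable_normalized {D : ℕ} : Measurable (normalized (D := D)) := by
  unfold normalized
  fun_prop

theorem normalized_smul {D : ℕ} {c : ℝ} (hc : c ≠ 0) (y : Fin (D + 1) → ℝ) :
    normalized (fun i => c * y i) = normalized y := by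
  ext i
  simp only [normalized, ← Finset.mul_sum]
  exact mul_div_mul_left _ _ hc

/-- The weight factors over the coordinates, and each factor turns rate `r` into `r - t` at the cost
of a constant. The tilted product is, up to these constants, the image of the original one under
scaling by `r / (r - t)`, which preserves `normalized ⁻¹' A`. -/
theorem pi_gammaMeasure_tilt {D : ℕ} {β : Fin (D + 1) → ℝ} (hβ : ∀ i, 0 < β i) {r t : ℝ}
    (hr : 0 < r) (ht : t < r) {A : Set (Fin D → ℝ)} (hA : MeasurableSet A) :
    ∫⁻ y in normalized ⁻¹' A, ENNReal.ofReal (Real.exp (t * ∑ i, y i))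
        ∂(Measure.pi fun i => gammaMeasure (β i) r)
      = ENNReal.ofReal ((r / (r - t)) ^ ∑ i, β i)
        * (Measure.pi fun i => gammaMeasure (β i) r) (normalized ⁻¹' A) := by
  have hrt : 0 < r - t := sub_pos.2 ht
  have hc : 0 < r / (r - t) := div_pos hr hrt
  have (i : Fin (D + 1)) : IsProbabilityMeasure (gammaMeasure (β i) r) :=
    isProbabilityMeasure_gammaMeasure (hβ i) hr
  have (i : Fin (D + 1)) : IsProbabilityMeasure (gammaMeasure (β i) (r - t)) :=
    isProbabilityMeasure_gammaMeasure (hβ i) hrt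
  have hsf (i) : IsFiniteMeasure (ENNReal.ofReal ((r / (r - t)) ^ β i) • gammaMeasure (β i) (r - t)) :=
    Measure.smul_finite _ ENNReal.ofReal_ne_top
  have hsf' (i) : SigmaFinite ((gammaMeasure (β i) r).withDensity
      fun x => ENNReal.ofReal (Real.exp (t * x))) := by
    rw [gammaMeasure_withDensity_exp hr ht]; infer_instance
  have hmap : (Measure.pi fun i => gammaMeasure (β i) (r - t))
      = (Measure.pi fun i => gammaMeasure (β i) r).map fun y i => r / (r - t) * y i := by
    have hi (i) : (gammaMeasure (β i) r).map (r / (r - t) * ·) = gammaMeasure (β i) (r - t) := by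
      rw [gammaMeasure_map_mul (hβ i) hr hc, div_div_cancel₀ hr.ne']
    have (i : Fin (D + 1)) : SigmaFinite ((gammaMeasure (β i) r).map (r / (r - t) * ·)) := by
      rw [hi]; infer_instance
    rw [Measure.pi_map_pi fun i => by fun_prop]
    simp_rw [hi]
  have hprod (y : Fin (D + 1) → ℝ) : ENNReal.ofReal (Real.exp (t * ∑ i, y i))
      = ∏ i, ENNReal.ofReal (Real.exp (t * y i)) := by
    rw [Finset.mul_sum, Real.exp_sum, ENNReal.ofReal_prod_of_nonneg fun i _ => (Real.exp_pos _).le]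
  simp_rw [hprod]
  rw [← withDensity_apply _ (measurable_normalized hA), pi_withDensity_prod
    (f := fun _ x => ENNReal.ofReal (Real.exp (t * x))) fun i => by fun_prop]
  simp_rw [gammaMeasure_withDensity_exp hr ht]
  rw [pi_smul_measure, Measure.smul_apply, smul_eq_mul, hmap,
    Measure.map_apply (by fun_prop) (measurable_normalized hA),
    ← ENNReal.ofReal_prod_of_nonneg fun i _ => by positivity, Real.rpow_sum_of_pos hc]
  congr 2
  ext y
  simp [normalized_smul hc.ne']

/-- The sum of independent gamma variables of a common rate is gamma distributed, and is independent
of the normalized vector. -/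
theorem pi_gammaMeasure_map_sum_normalized {D : ℕ} {β : Fin (D + 1) → ℝ} (hβ : ∀ i, 0 < β i)
    {r : ℝ} (hr : 0 < r) :
    (Measure.pi fun i => gammaMeasure (β i) r).map (fun y => (∑ i, y i, normalized y))
      = (gammaMeasure (∑ i, β i) r).prod
        ((Measure.pi fun i => gammaMeasure (β i) r).map normalized) := by
  have (i : Fin (D + 1)) : IsProbabilityMeasure (gammaMeasure (β i) r) :=
    isProbabilityMeasure_gammaMeasure (hβ i) hr
  have hsum : 0 < ∑ i, β i := Finset.sum_pos (fun i _ => hβ i) Finset.univ_nonempty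
  have := isProbabilityMeasure_gammaMeasure hsum hr
  set P := Measure.pi fun i => gammaMeasure (β i) r with hP
  have hPn : IsProbabilityMeasure (P.map normalized) :=
    Measure.isProbabilityMeasure_map measurable_normalized.aemeasurable
  refine (Measure.prod_eq fun s A hs hA => ?_).symm
  -- For fixed `A` both sides have the same exponential integrals. That the sum is gamma distributed
  -- needs no separate proof: it is the case of `A` the whole space.
  have key : (P.restrict (normalized ⁻¹' A)).map (fun y => ∑ i, y i)
      = P (normalized ⁻¹' A) • gammaMeasure (∑ i, β i) r := by
    have : IsFiniteMeasure (P (normalized ⁻¹' A) • gammaMeasure (∑ i, β i) r) :=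
      Measure.smul_finite _ (measure_ne_top _ _)
    have hexp (t : ℝ) (ht : t < r) : ∫⁻ x, ENNReal.ofReal (Real.exp (t * x))
        ∂(P (normalized ⁻¹' A) • gammaMeasure (∑ i, β i) r)
        = ENNReal.ofReal ((r / (r - t)) ^ ∑ i, β i) * P (normalized ⁻¹' A) := by
      rw [lintegral_smul_measure, lintegral_exp_gammaMeasure hsum hr ht, smul_eq_mul, mul_comm]
    refine Measure.ext_of_lintegral_exp_eq hr (fun t ht => ?_) fun t ht => ?_
    · rw [hexp t ht]
      exact ENNReal.mul_ne_top ENNReal.ofReal_ne_top (measure_ne_top _ _)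
    · rw [hexp t ht, lintegral_map (by fun_prop) (by fun_prop), hP,
        pi_gammaMeasure_tilt hβ hr ht hA]
  have h := congrArg (· s) key
  rw [Measure.map_apply (by fun_prop) hs, Measure.restrict_apply (by measurability),
    Measure.smul_apply, smul_eq_mul] at h
  rw [Measure.map_apply (by fun_prop) (hs.prod hA), Measure.map_apply (by fun_prop) hA, mul_comm, ← h]
  rfl

/-! ### Bayes' formula for a discrete parameter -/

section Posterior

variable {N E : Type*} [MeasurableSpace N] [Countable N] [MeasurableSingletonClass N]
  [MeasurableSpace E]

/-- The posterior distribution of a discrete variable with prior `W`, given an observation with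
conditional densities `g n`. Where the marginal density is degenerate, it takes its value
at `t₀`. -/
noncomputable def discretePosterior (W : Measure N) [IsProbabilityMeasure W] (g : N → ℝ → ℝ≥0∞) (t₀ : ℝ) :
    Kernel ℝ N :=
  open Classical in
  Kernel.withDensity (Kernel.const ℝ W) fun t n =>
    if ∫⁻ m, g m t ∂W ≠ 0 ∧ ∫⁻ m, g m t ∂W ≠ ∞ then g n t / ∫⁻ m, g m t ∂W
    else g n t₀ / ∫⁻ m, g m t₀ ∂W

variable {W : Measure N} {g : N → ℝ → ℝ≥0∞} {t₀ : ℝ}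

theorem measurable_uncurry_of_countable (hg : ∀ n, Measurable (g n)) :
    Measurable fun p : ℝ × N => g p.2 p.1 :=
  measurable_from_prod_countable_left hg

theorem measurable_lintegral_of_countable [SFinite W] (hg : ∀ n, Measurable (g n)) :
    Measurable fun t => ∫⁻ n, g n t ∂W :=
  (measurable_uncurry_of_countable hg).lintegral_prod_right'

theorem measurable_posterior_density [SFinite W] (hg : ∀ n, Measurable (g n)) :
    open Classical in
    Measurable (Function.uncurry fun t n =>
      if ∫⁻ m, g m t ∂W ≠ 0 ∧ ∫⁻ m, g m t ∂W ≠ ∞ then g n t / ∫⁻ m, g m t ∂W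
      else g n t₀ / ∫⁻ m, g m t₀ ∂W) := by
  have hH := measurable_lintegral_of_countable (W := W) hg
  refine Measurable.ite ?_ ?_ ?_
  · exact measurable_fst (((measurableSet_singleton 0).compl.inter
      (measurableSet_singleton ∞).compl).preimage hH)
  · exact (measurable_uncurry_of_countable hg).div (hH.comp measurable_fst)
  · exact (measurable_of_countable fun n => g n t₀ / _).comp measurable_snd

variable [IsProbabilityMeasure W]

theorem lintegral_marginal_ne_top (hg : ∀ n, Measurable (g n))
    (hg1 : ∀ n, IsProbabilityMeasure (volume.withDensity (g n))) :
    ∫⁻ t, ∫⁻ n, g n t ∂W ≠ ∞ := by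
  rw [lintegral_lintegral_swap (measurable_uncurry_of_countable hg).aemeasurable]
  have (n : N) : ∫⁻ t, g n t = 1 := by
    rw [← setLIntegral_univ, ← withDensity_apply _ .univ]
    exact (hg1 n).measure_univ
  simp [this]

theorem posterior_apply (hg : ∀ n, Measurable (g n)) {t : ℝ} (h0 : ∫⁻ m, g m t ∂W ≠ 0)
    (h1 : ∫⁻ m, g m t ∂W ≠ ∞) :
    discretePosterior W g t₀ t = W.withDensity fun n => g n t / ∫⁻ m, g m t ∂W := by
  rw [discretePosterior, Kernel.withDensity_apply _ (measurable_posterior_density hg)]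
  simp [h0, h1]

/-- Where the marginal density is `0` or `∞`, the fallback to `t₀`, whose marginal is nondegenerate,
still gives total mass one. -/
theorem isMarkovKernel_posterior (hg : ∀ n, Measurable (g n)) (h0 : ∫⁻ m, g m t₀ ∂W ≠ 0)
    (h1 : ∫⁻ m, g m t₀ ∂W ≠ ∞) : IsMarkovKernel (discretePosterior W g t₀) := by
  refine ⟨fun t => ⟨?_⟩⟩
  have key (t : ℝ) (h0 : ∫⁻ m, g m t ∂W ≠ 0) (h1 : ∫⁻ m, g m t ∂W ≠ ∞) :
      ∫⁻ n, g n t / ∫⁻ m, g m t ∂W ∂W = 1 := by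
    simp_rw [ENNReal.div_eq_inv_mul]
    rw [lintegral_const_mul _ (measurable_of_countable _), ENNReal.inv_mul_cancel h0 h1]
  rw [discretePosterior, Kernel.withDensity_apply _ (measurable_posterior_density hg),
    withDensity_apply _ .univ, setLIntegral_univ, Kernel.const_apply]
  split_ifs with h
  · exact key t h.1 h.2
  · exact key t₀ h0 h1

/-- Bayes' formula: the joint law of an observation `t` and of a variable `z` with conditional
law `J n` disintegrates along `t` through the posterior distribution of `n`. -/
theorem withDensity_compProd_posterior (hg : ∀ n, Measurable (g n))
    (hg1 : ∀ n, IsProbabilityMeasure (volume.withDensity (g n)))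
    (h0 : ∫⁻ m, g m t₀ ∂W ≠ 0) (h1 : ∫⁻ m, g m t₀ ∂W ≠ ∞) (J : Kernel N E) [IsMarkovKernel J] :
    (volume.withDensity fun t => ∫⁻ n, g n t ∂W) ⊗ₘ (J ∘ₖ discretePosterior W g t₀)
      = W.bind fun n => (volume.withDensity (g n)).prod (J n) := by
  have := isMarkovKernel_posterior hg h0 h1
  have hH := measurable_lintegral_of_countable (W := W) hg
  have htop := lintegral_marginal_ne_top (W := W) hg hg1
  have hae : ∀ᵐ t, ∫⁻ n, g n t ∂W < ∞ := ae_lt_top hH htop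
  have : IsFiniteMeasure (volume.withDensity fun t => ∫⁻ n, g n t ∂W) :=
    isFiniteMeasure_withDensity htop
  ext s hs
  have hJ (n : N) : Measurable fun t => J n (Prod.mk t ⁻¹' s) := measurable_measure_prodMk_left hs
  rw [Measure.compProd_apply hs, lintegral_withDensity_eq_lintegral_mul _ hH
    (Kernel.measurable_kernel_prodMk_left hs),
    Measure.bind_apply hs (measurable_of_countable _).aemeasurable]
  simp_rw [Measure.prod_apply hs]
  have hr (n : N) : ∫⁻ t, J n (Prod.mk t ⁻¹' s) ∂(volume.withDensity (g n))
      = ∫⁻ t, g n t * J n (Prod.mk t ⁻¹' s) :=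
    lintegral_withDensity_eq_lintegral_mul _ (hg n) (hJ n)
  simp_rw [hr]
  rw [lintegral_lintegral_swap (μ := W)
    (measurable_from_prod_countable_right fun n => (hg n).mul (hJ n)).aemeasurable]
  refine lintegral_congr_ae ?_
  filter_upwards [hae] with t ht
  simp only [Pi.mul_apply]
  -- Where the marginal density vanishes, both sides are zero and the fallback value is irrelevant;
  -- elsewhere the marginal density cancels the denominator of the posterior.
  by_cases hz : ∫⁻ n, g n t ∂W = 0
  · rw [hz, zero_mul]
    rw [lintegral_eq_zero_iff (measurable_of_countable _)] at hz
    refine (lintegral_eq_zero_iff (measurable_of_countable _)).2 ?_ |>.symm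
    filter_upwards [hz] with n hn
    simp only [Pi.zero_apply] at hn
    simp [hn]
  · rw [Kernel.comp_apply, Measure.bind_apply (measurable_prodMk_left hs) J.aemeasurable,
      posterior_apply hg hz ht.ne,
      lintegral_withDensity_eq_lintegral_mul _ (measurable_of_countable _)
        (measurable_of_countable _), ← lintegral_const_mul _ (measurable_of_countable _)]
    refine lintegral_congr fun n => ?_
    simp only [Pi.mul_apply]
    rw [← mul_assoc, ENNReal.mul_div_cancel hz ht.ne]

/-- Near `t₀` the posterior mean of `F` is the quotient of `∫ g F` by `∫ g`. Both are continuous at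
`t₀` by dominated convergence, a constant bound being integrable for the probability `W`, and the
denominator is nonzero at `t₀`. -/
theorem continuousAt_integral_posterior (hg : ∀ n, Measurable (g n)) {C : ℝ≥0}
    (hC : ∀ᶠ t in 𝓝 t₀, ∀ n, g n t ≤ C) (hcont : ∀ n, ContinuousAt (g n) t₀)
    (h0 : ∫⁻ m, g m t₀ ∂W ≠ 0) {F : N → ℝ} {B : ℝ} (hF : ∀ n, |F n| ≤ B) :
    ContinuousAt (fun t => ∫ n, F n ∂(discretePosterior W g t₀ t)) t₀ := by
  have hfin (t : ℝ) (ht : ∀ n, g n t ≤ C) : ∫⁻ n, g n t ∂W ≠ ∞ := by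
    refine ne_top_of_le_ne_top (ENNReal.coe_ne_top (r := C)) ?_
    calc ∫⁻ n, g n t ∂W ≤ ∫⁻ _, C ∂W := lintegral_mono ht
      _ = C := by simp
  have hnum (G : N → ℝ) (B : ℝ) (hG : ∀ n, |G n| ≤ B) :
      ContinuousAt (fun t => ∫ n, (g n t).toReal * G n ∂W) t₀ := by
    refine continuousAt_of_dominated (bound := fun _ => C * B)
      (.of_forall fun t => (measurable_of_countable _).aestronglyMeasurable) ?_
      (integrable_const _) (ae_of_all _ fun n => ?_)
    · filter_upwards [hC] with t ht
      refine ae_of_all _ fun n => ?_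
      rw [Real.norm_eq_abs, abs_mul, abs_of_nonneg ENNReal.toReal_nonneg]
      refine mul_le_mul ?_ (hG n) (abs_nonneg _) C.coe_nonneg
      exact ENNReal.toReal_le_of_le_ofReal C.coe_nonneg (by simpa using ht n)
    · refine ContinuousAt.mul ?_ continuousAt_const
      exact (ENNReal.tendsto_toReal
        (ne_top_of_le_ne_top ENNReal.coe_ne_top (hC.self_of_nhds n))).comp (hcont n)
  have hden (t : ℝ) (ht : ∀ n, g n t ≤ C) :
      (∫⁻ n, g n t ∂W).toReal = ∫ n, (g n t).toReal * 1 ∂W := by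
    simp_rw [mul_one]
    exact (integral_toReal (measurable_of_countable _).aemeasurable
      (ae_of_all _ fun n => (ht n).trans_lt ENNReal.coe_lt_top)).symm
  have hne : ∫ n, (g n t₀).toReal * 1 ∂W ≠ 0 := by
    rw [← hden t₀ hC.self_of_nhds]
    exact ENNReal.toReal_ne_zero.2 ⟨h0, hfin _ hC.self_of_nhds⟩
  have hd := hnum (fun _ => 1) 1 (by simp)
  refine ((hnum F B hF).div hd hne).congr ?_
  filter_upwards [hC, hd.eventually_ne hne] with t ht htne
  have h0' : ∫⁻ n, g n t ∂W ≠ 0 := by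
    intro h
    rw [← hden t ht, h] at htne
    simp at htne
  rw [posterior_apply hg h0' (hfin t ht),
    integral_withDensity_eq_integral_toReal_smul (measurable_of_countable _)
      (ae_of_all _ fun n => ENNReal.div_lt_top
        ((ht n).trans_lt ENNReal.coe_lt_top).ne h0'), Pi.div_apply, ← hden t ht,
    ← integral_div]
  refine integral_congr_ae (ae_of_all _ fun n => ?_)
  simp only [ENNReal.toReal_div, smul_eq_mul]
  ring

end Posterior

/-! ### Conditional laws at a point: existence and transport -/

/-- A mixture of observations with densities has, at a point near which these are uniformly bounded
and continuous, the mixture by the posterior distribution as its conditional law. -/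
theorem isCondLawAt_posterior {Ω N E : Type*} [MeasurableSpace N] [Countable N]
    [MeasurableSingletonClass N] [MeasurableSpace E] [TopologicalSpace E] [BorelSpace E]
    [MeasurableSpace Ω] {P : Measure Ω} {T : Ω → ℝ} {Z : Ω → E} (hT : Measurable T)
    (hZ : Measurable Z) {W : Measure N} [IsProbabilityMeasure W] {g : N → ℝ → ℝ≥0∞} {t₀ : ℝ}
    (hg : ∀ n, Measurable (g n)) (hg1 : ∀ n, IsProbabilityMeasure (volume.withDensity (g n)))
    {C : ℝ≥0} (hC : ∀ᶠ t in 𝓝 t₀, ∀ n, g n t ≤ C) (hcont : ∀ n, ContinuousAt (g n) t₀)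
    (hpos : ∀ᶠ t in 𝓝 t₀, ∀ n, g n t ≠ 0) (J : Kernel N E) [IsMarkovKernel J]
    (hP : P.map (fun ω => (T ω, Z ω)) = W.bind fun n => (volume.withDensity (g n)).prod (J n)) :
    IsCondLawAt P Z T t₀ (J ∘ₘ discretePosterior W g t₀ t₀) := by
  have hne (t : ℝ) (ht : ∀ n, g n t ≠ 0) : ∫⁻ n, g n t ∂W ≠ 0 := by
    rw [Ne, lintegral_eq_zero_iff (measurable_of_countable _)]
    intro h
    obtain ⟨n, hn⟩ := h.exists
    exact ht n hn
  have h0 := hne t₀ hpos.self_of_nhds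
  have h1 : ∫⁻ n, g n t₀ ∂W ≠ ∞ := by
    refine ne_top_of_le_ne_top (ENNReal.coe_ne_top (r := C)) ?_
    calc ∫⁻ n, g n t₀ ∂W ≤ ∫⁻ _, C ∂W := lintegral_mono hC.self_of_nhds
      _ = C := by simp
  have hH := measurable_lintegral_of_countable (W := W) hg
  have := isMarkovKernel_posterior hg h0 h1
  have hbayes := withDensity_compProd_posterior hg hg1 h0 h1 J
  have htop := lintegral_marginal_ne_top (W := W) hg hg1
  have : IsFiniteMeasure (volume.withDensity fun t => ∫⁻ n, g n t ∂W) :=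
    isFiniteMeasure_withDensity htop
  have hPT : P.map T = volume.withDensity fun t => ∫⁻ n, g n t ∂W := by
    rw [← Measure.fst_compProd (volume.withDensity fun t => ∫⁻ n, g n t ∂W)
      (J ∘ₖ discretePosterior W g t₀), hbayes, ← hP, Measure.fst, Measure.map_map (by fun_prop) (by fun_prop)]
    rfl
  refine ⟨?_, J ∘ₖ discretePosterior W g t₀, inferInstance, by rw [hPT, hbayes, hP], fun f => ?_,
    Kernel.comp_apply _ _ _⟩
  · rw [hPT, Measure.mem_support_iff_forall]
    intro U hU
    rw [pos_iff_ne_zero, Ne, withDensity_apply_eq_zero hH]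
    refine (Measure.measure_pos_of_mem_nhds volume (Filter.inter_mem ?_ hU)).ne'
    filter_upwards [hpos] with t ht using hne t ht
  · have hint (s : ℝ) : ∫ z, f z ∂((J ∘ₖ discretePosterior W g t₀) s)
        = ∫ n, ∫ z, f z ∂(J n) ∂(discretePosterior W g t₀ s) := by
      exact Kernel.integral_comp (BoundedContinuousFunction.integrable _ f)
    simp_rw [hint]
    -- Integrating `f` against `J n` leaves a function of `n` bounded by `‖f‖`. As `n` is discrete,
    -- no continuity of `J` is required.
    refine continuousAt_integral_posterior hg hC hcont h0 (B := ‖f‖) fun n => ?_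
    rw [← Real.norm_eq_abs]
    refine (norm_integral_le_of_norm_le_const (ae_of_all _ f.norm_coe_le_norm)).trans ?_
    simp

/-- Continuity of `φ` is what makes bounded continuous test functions pull back to such functions,
so that weak continuity survives. -/
theorem IsCondLawAt.map {Ω E F : Type*} [MeasurableSpace Ω] [MeasurableSpace E] [TopologicalSpace E]
    [MeasurableSpace F] [TopologicalSpace F] [OpensMeasurableSpace F] {P : Measure Ω}
    [IsFiniteMeasure P] {Z : Ω → E} {T : Ω → ℝ} {t : ℝ} {ρ : Measure E} (hZ : Measurable Z)
    (hT : Measurable T) {φ : E → F} (hφ : Continuous φ) (hφm : Measurable φ)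
    (h : IsCondLawAt P Z T t ρ) : IsCondLawAt P (fun ω => φ (Z ω)) T t (ρ.map φ) := by
  obtain ⟨ht, κ, hκ, hd, hc, rfl⟩ := h
  refine ⟨ht, κ.map φ, Kernel.IsMarkovKernel.map _ hφm, ?_, fun f => ?_, Kernel.map_apply _ hφm _⟩
  · rw [Measure.compProd_map hφm, hd, Measure.map_map (by fun_prop) (by fun_prop)]
    rfl
  · have hint (s : ℝ) : ∫ z, f z ∂(κ.map φ s) = ∫ z, f.compContinuous ⟨φ, hφ⟩ z ∂(κ s) := by
      rw [Kernel.map_apply _ hφm]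
      exact integral_map_of_stronglyMeasurable hφm f.continuous.measurable.stronglyMeasurable
    simp_rw [hint]
    exact hc _

/-- This passes from the space of pairs `(M_i, Y'_i)` to that of the `Y'_i` alone, on which
`IsCNcDir` is stated. -/
theorem IsCondLawAt.of_comp {Ω Ω' E : Type*} [MeasurableSpace Ω] [MeasurableSpace Ω']
    [MeasurableSpace E] [TopologicalSpace E] {P : Measure Ω} {φ : Ω → Ω'} {Z : Ω' → E} {T : Ω' → ℝ}
    {t : ℝ} {ρ : Measure E} (hφ : Measurable φ) (hZ : Measurable Z) (hT : Measurable T)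
    (h : IsCondLawAt P (fun ω => Z (φ ω)) (fun ω => T (φ ω)) t ρ) :
    IsCondLawAt (P.map φ) Z T t ρ := by
  have h1 : (P.map φ).map T = P.map fun ω => T (φ ω) := Measure.map_map hT hφ
  have h2 : (P.map φ).map (fun ω => (T ω, Z ω)) = P.map fun ω => (T (φ ω), Z (φ ω)) :=
    Measure.map_map (by fun_prop) hφ
  rw [IsCondLawAt, h1, h2]
  exact h

/-! ### Uniform bounds for gamma densities near `1` -/

/-- By `Γ(x + 1) = x Γ(x)`, the sequence is nondecreasing from `k = 1` on, because then `a + k ≥ 1`.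
Only the values `Γ(a)` and `a Γ(a)` at `k = 0, 1` compete for the minimum. -/
theorem exists_pos_le_Gamma_add_natCast {a : ℝ} (ha : 0 < a) :
    ∃ c > 0, ∀ k : ℕ, c ≤ Real.Gamma (a + k) := by
  have hG := Real.Gamma_pos_of_pos ha
  refine ⟨min (Real.Gamma a) (a * Real.Gamma a), by positivity, fun k => ?_⟩
  have hsucc (k : ℕ) : a * Real.Gamma a ≤ Real.Gamma (a + (k + 1 : ℕ)) := by
    induction k with
    | zero => simp [Real.Gamma_add_one ha.ne']
    | succ k ih =>
      have hk : 1 ≤ a + (k + 1 : ℕ) := by push_cast; linarith [k.cast_nonneg (α := ℝ)]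
      have hs : a + ((k + 1 + 1 : ℕ) : ℝ) = a + (k + 1 : ℕ) + 1 := by push_cast; ring
      rw [hs, Real.Gamma_add_one (by positivity)]
      exact ih.trans (le_mul_of_one_le_left (Real.Gamma_pos_of_pos (by positivity)).le hk)
  cases k with
  | zero => simp
  | succ k => exact (min_le_right _ _).trans (hsucc k)

/-- The densities of the gamma distributions of rate `1 / 2` with shapes `a + k` are uniformly
bounded near `1`. -/
theorem exists_gammaPDF_add_natCast_le {a : ℝ} (ha : 0 < a) :
    ∃ C : ℝ≥0, ∀ᶠ t in 𝓝 (1 : ℝ), ∀ k : ℕ, gammaPDF (a + k) (1 / 2) t ≤ C := by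
  obtain ⟨c, hc, hΓ⟩ := exists_pos_le_Gamma_add_natCast ha
  -- On `1/2 < t < 2` the base `t / 2` is below `1`, so its powers decrease in the exponent `a + k -
  -- 1 ≥ -1` and are at most `2 / t ≤ 4`. The remaining factor `1 / 2` gives `2`, and `c` bounds the
  -- Gamma function from below.
  refine ⟨(2 / c).toNNReal, ?_⟩
  filter_upwards [Ioo_mem_nhds (show (1 / 2 : ℝ) < 1 by norm_num) (show (1 : ℝ) < 2 by norm_num)]
    with t ht k
  have ht0 : 0 < t := by linarith [ht.1]
  have hak : 0 < a + k := by positivity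
  rw [gammaPDF_of_nonneg ht0.le]
  refine ENNReal.ofReal_le_ofReal ?_
  have hexp : Real.exp (-(1 / 2 * t)) ≤ 1 := Real.exp_le_one_iff.2 (by linarith)
  have hpow : (1 / 2 : ℝ) ^ (a + k) * t ^ (a + k - 1) ≤ 2 := by
    have h1 : (1 / 2 : ℝ) ^ (a + k) * t ^ (a + k - 1) = 1 / 2 * (t / 2) ^ (a + k - 1) := by
      have : (1 / 2 : ℝ) ^ (a + k) = 1 / 2 * (1 / 2) ^ (a + k - 1) := by
        rw [Real.rpow_sub_one (by norm_num)]; ring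
      rw [this, div_eq_mul_one_div t 2, Real.mul_rpow ht0.le (by norm_num)]
      ring
    have h2 : (t / 2) ^ (a + k - 1) ≤ (t / 2) ^ (-1 : ℝ) :=
      Real.rpow_le_rpow_of_exponent_ge (by positivity) (by linarith [ht.2]) (by linarith)
    have h3 : (t / 2) ^ (-1 : ℝ) ≤ 4 := by
      rw [Real.rpow_neg_one, inv_div, div_le_iff₀ ht0]
      linarith [ht.1]
    rw [h1]; linarith
  calc (1 / 2 : ℝ) ^ (a + k) / Real.Gamma (a + k) * t ^ (a + k - 1) * Real.exp (-(1 / 2 * t))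
      ≤ (1 / 2 : ℝ) ^ (a + k) / Real.Gamma (a + k) * t ^ (a + k - 1) := by
        have := Real.Gamma_pos_of_pos hak
        exact mul_le_of_le_one_right (by positivity) hexp
    _ = (1 / 2 : ℝ) ^ (a + k) * t ^ (a + k - 1) / Real.Gamma (a + k) := by ring
    _ ≤ 2 / c := div_le_div₀ (by norm_num) hpow hc (hΓ k)

theorem continuousAt_gammaPDF {a r t : ℝ} (ht : 0 < t) : ContinuousAt (gammaPDF a r) t := by
  have h : ContinuousAt
      (fun x => ENNReal.ofReal (r ^ a / Real.Gamma a * x ^ (a - 1) * Real.exp (-(r * x)))) t := by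
    refine ENNReal.continuous_ofReal.continuousAt.comp ?_
    have := Real.continuousAt_rpow_const t (a - 1) (.inl ht.ne')
    fun_prop
  refine h.congr ?_
  filter_upwards [lt_mem_nhds ht] with x hx using (gammaPDF_of_nonneg hx.le).symm

/-! ### The law of the pairs as a Poisson mixture -/

theorem chiSq_two_mul (a : ℝ) : chiSq (2 * a) = gammaMeasure a (1 / 2) := by
  rw [chiSq, mul_div_cancel_left₀ _ two_ne_zero]

theorem isProbabilityMeasure_chiSq {g : ℝ} (hg : 0 < g) : IsProbabilityMeasure (chiSq g) :=
  isProbabilityMeasure_gammaMeasure (half_pos hg) (by norm_num)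

theorem isProbabilityMeasure_dirichlet {D : ℕ} {α : Fin (D + 1) → ℝ} (hα : ∀ i, 0 < α i) :
    IsProbabilityMeasure (dirichlet α) := by
  have (i : Fin (D + 1)) : IsProbabilityMeasure (chiSq (2 * α i)) :=
    isProbabilityMeasure_chiSq (mul_pos two_pos (hα i))
  exact Measure.isProbabilityMeasure_map measurable_normalized.aemeasurable

theorem ncChiSqJoint_apply (g : ℝ) (l : ℝ≥0) {s : Set (ℕ × ℝ)} (hs : MeasurableSet s) :
    ncChiSqJoint g l s = ∫⁻ m, chiSq (g + 2 * m) (Prod.mk m ⁻¹' s) ∂(poissonMeasure (l / 2)) := by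
  rw [ncChiSqJoint, Measure.bind_apply hs (measurable_of_countable _).aemeasurable]
  exact lintegral_congr fun m => Measure.map_apply (by fun_prop) hs

theorem isProbabilityMeasure_ncChiSqJoint {g : ℝ} (hg : 0 < g) (l : ℝ≥0) :
    IsProbabilityMeasure (ncChiSqJoint g l) := by
  refine ⟨?_⟩
  have (m : ℕ) : IsProbabilityMeasure (chiSq (g + 2 * m)) :=
    isProbabilityMeasure_chiSq (by positivity)
  rw [ncChiSqJoint_apply _ _ .univ]
  simp

theorem isProbabilityMeasure_pairLaw {D : ℕ} {α : Fin (D + 1) → ℝ} (hα : ∀ i, 0 < α i)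
    (l : Fin (D + 1) → ℝ≥0) : IsProbabilityMeasure (pairLaw α l) := by
  have (i : Fin (D + 1)) : IsProbabilityMeasure (ncChiSqJoint (2 * α i) (l i)) :=
    isProbabilityMeasure_ncChiSqJoint (mul_pos two_pos (hα i)) _
  exact inferInstanceAs (IsProbabilityMeasure (Measure.pi _))

theorem pi_ncChiSq_eq_map_pairLaw {D : ℕ} {α : Fin (D + 1) → ℝ} (hα : ∀ i, 0 < α i)
    (l : Fin (D + 1) → ℝ≥0) :
    (Measure.pi fun i => ncChiSq (2 * α i) (l i)) = (pairLaw α l).map fun p i => (p i).2 := by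
  have (i : Fin (D + 1)) : IsProbabilityMeasure (ncChiSqJoint (2 * α i) (l i)) :=
    isProbabilityMeasure_ncChiSqJoint (mul_pos two_pos (hα i)) _
  have hsf (i : Fin (D + 1)) : SigmaFinite ((ncChiSqJoint (2 * α i) (l i)).map Prod.snd) :=
    have := Measure.isProbabilityMeasure_map (μ := ncChiSqJoint (2 * α i) (l i))
      measurable_snd.aemeasurable
    inferInstance
  exact (Measure.pi_map_pi (hμ := hsf) fun i => measurable_snd.aemeasurable).symm

/-- Given the Poisson variables, the chi-squared variables are independent. -/
theorem pairLaw_eq_bind {D : ℕ} {α : Fin (D + 1) → ℝ} (hα : ∀ i, 0 < α i)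
    (l : Fin (D + 1) → ℝ≥0) :
    pairLaw α l = (Measure.pi fun i => poissonMeasure (l i / 2)).bind fun n =>
      (Measure.pi fun i => chiSq (2 * (α i + n i))).map fun y i => (n i, y i) := by
  have hchi (i : Fin (D + 1)) (m : ℕ) : IsProbabilityMeasure (chiSq (2 * (α i + m))) :=
    isProbabilityMeasure_chiSq (mul_pos two_pos (add_pos_of_pos_of_nonneg (hα i) m.cast_nonneg))
  have (i : Fin (D + 1)) : IsProbabilityMeasure (ncChiSqJoint (2 * α i) (l i)) :=
    isProbabilityMeasure_ncChiSqJoint (mul_pos two_pos (hα i)) _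
  refine Measure.pi_eq fun s hs => ?_
  rw [Measure.bind_apply (.univ_pi hs) (measurable_of_countable _).aemeasurable]
  simp_rw [ncChiSqJoint_apply _ _ (hs _), ← mul_add]
  rw [← lintegral_fintype_prod_eq_prod fun i => measurable_of_countable _]
  refine lintegral_congr fun n => ?_
  rw [Measure.map_apply (by fun_prop) (.univ_pi hs), ← Measure.pi_pi]
  rfl

/-! ### Dirichlet kernel, mixture weights and the joint conditional law -/

/-- The Dirichlet distributions `Dir(α + n)` as a kernel in `n`. -/
noncomputable def dirichletKernel {D : ℕ} (α : Fin (D + 1) → ℝ) :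
    Kernel (Fin (D + 1) → ℕ) (Fin D → ℝ) where
  toFun n := dirichlet fun i => α i + n i
  measurable' := measurable_of_countable _

theorem dirichletKernel_apply {D : ℕ} (α : Fin (D + 1) → ℝ) (n : Fin (D + 1) → ℕ) :
    dirichletKernel α n = dirichlet fun i => α i + n i := rfl

theorem isMarkovKernel_dirichletKernel {D : ℕ} {α : Fin (D + 1) → ℝ} (hα : ∀ i, 0 < α i) :
    IsMarkovKernel (dirichletKernel α) :=
  ⟨fun n => isProbabilityMeasure_dirichlet
    fun i => add_pos_of_pos_of_nonneg (hα i) (n i).cast_nonneg⟩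

/-- The mixture weights `MW(a, l)`. -/
noncomputable def mixtureWeight {D : ℕ} (a : ℝ) (l : Fin (D + 1) → ℝ≥0) :
    Measure (Fin (D + 1) → ℕ) :=
  discretePosterior (Measure.pi fun i => poissonMeasure (l i / 2))
    (fun n => gammaPDF (a + (∑ i, n i : ℕ)) (1 / 2)) 1 1

/-- This is the product form required by `isCondLawAt_posterior`. The factor `Kernel.id` carries `n`
along as a Dirac mass, so that the conditional law obtained is joint in `(X', M)`. -/
theorem pairLaw_map {D : ℕ} {α : Fin (D + 1) → ℝ} (hα : ∀ i, 0 < α i) (l : Fin (D + 1) → ℝ≥0) :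
    (pairLaw α l).map
        (fun p => (∑ i, (p i).2, (normalized fun i => (p i).2, fun i => (p i).1)))
      = (Measure.pi fun i => poissonMeasure (l i / 2)).bind fun n =>
        (volume.withDensity (gammaPDF (∑ i, α i + (∑ i, n i : ℕ)) (1 / 2))).prod
          ((dirichletKernel α ×ₖ Kernel.id) n) := by
  have := isMarkovKernel_dirichletKernel hα
  ext s hs
  rw [Measure.map_apply (by fun_prop) hs, pairLaw_eq_bind hα,
    Measure.bind_apply (hs.preimage (by fun_prop)) (measurable_of_countable _).aemeasurable,
    Measure.bind_apply hs (measurable_of_countable _).aemeasurable]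
  refine lintegral_congr fun n => ?_
  have hn (i : Fin (D + 1)) : 0 < α i + n i := add_pos_of_pos_of_nonneg (hα i) (n i).cast_nonneg
  have hsum : ∑ i, (α i + n i) = ∑ i, α i + (∑ i, n i : ℕ) := by
    push_cast; exact Finset.sum_add_distrib
  have hprob := isProbabilityMeasure_gammaMeasure
    (Finset.sum_pos (fun i _ => hn i) Finset.univ_nonempty) (show (0 : ℝ) < 1 / 2 by norm_num)
  have h := pi_gammaMeasure_map_sum_normalized hn (r := 1 / 2) (by norm_num)
  rw [hsum] at hprob h
  simp_rw [← chiSq_two_mul] at h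
  have hdir := isProbabilityMeasure_dirichlet hn
  have hJ : (dirichletKernel α ×ₖ Kernel.id) n
      = (dirichlet fun i => α i + n i).map fun x => (x, n) := by
    rw [Kernel.prod_apply, Kernel.id_apply, Measure.prod_dirac, dirichletKernel_apply]
  -- `gammaMeasure` is by definition `volume` with density `gammaPDF`.
  change _ = ((gammaMeasure _ _).prod _) s
  rw [chiSq_two_mul] at h
  rw [hJ, ← Measure.map_id (μ := gammaMeasure _ _), Measure.map_prod_map _ _ (by fun_prop)
    (by fun_prop), dirichlet, ← h, Measure.map_map (by fun_prop) (by fun_prop),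
    Measure.map_apply (by fun_prop) hs,
    Measure.map_apply (by fun_prop) (hs.preimage (by fun_prop))]
  rfl

/-- The density of the sum depends on `n` only through `∑ n_i`, so a bound uniform over the shapes
`a + k`, `k : ℕ`, is uniform in `n`. -/
theorem isCNcDirJoint_bind_mixtureWeight {D : ℕ} {α : Fin (D + 1) → ℝ} (hα : ∀ i, 0 < α i)
    (l : Fin (D + 1) → ℝ≥0) :
    IsCNcDirJoint α l ((dirichletKernel α ×ₖ Kernel.id) ∘ₘ mixtureWeight (∑ i, α i) l) := by
  have hsum : 0 < ∑ i, α i := Finset.sum_pos (fun i _ => hα i) Finset.univ_nonempty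
  have := isMarkovKernel_dirichletKernel hα
  obtain ⟨C, hC⟩ := exists_gammaPDF_add_natCast_le hsum
  refine isCondLawAt_posterior (by fun_prop) (by fun_prop)
    (fun n => (measurable_gammaPDFReal _ _).ennreal_ofReal)
    (fun n => isProbabilityMeasure_gammaMeasure (by positivity) (by norm_num)) (C := C) ?_
    (fun n => continuousAt_gammaPDF one_pos) ?_ _ (pairLaw_map hα l)
  · filter_upwards [hC] with t ht n using ht _
  · filter_upwards [lt_mem_nhds one_pos] with t ht n
    exact (ENNReal.ofReal_pos.2 (gammaPDFReal_pos (by positivity) (by norm_num) ht)).ne'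

/-! ### Marginals, uniqueness and the main theorem -/

theorem dirichletKernel_prod_id_map_fst {D : ℕ} {α : Fin (D + 1) → ℝ} (hα : ∀ i, 0 < α i)
    (ν : Measure (Fin (D + 1) → ℕ)) :
    ((dirichletKernel α ×ₖ Kernel.id) ∘ₘ ν).map Prod.fst = dirichletKernel α ∘ₘ ν := by
  have := isMarkovKernel_dirichletKernel hα
  rw [Measure.map_comp _ _ measurable_fst, ← Kernel.fst_eq, Kernel.fst_prod]

theorem dirichletKernel_prod_id_map_snd {D : ℕ} {α : Fin (D + 1) → ℝ} (hα : ∀ i, 0 < α i)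
    (ν : Measure (Fin (D + 1) → ℕ)) :
    ((dirichletKernel α ×ₖ Kernel.id) ∘ₘ ν).map Prod.snd = ν := by
  have := isMarkovKernel_dirichletKernel hα
  rw [Measure.map_comp _ _ measurable_snd, ← Kernel.snd_eq, Kernel.snd_prod, Measure.id_comp]

/-- Conditioning on `N` disintegrates the law of `(N, X)`, whence the swap. -/
theorem dirichletKernel_prod_id_map_swap {D : ℕ} {α : Fin (D + 1) → ℝ} (hα : ∀ i, 0 < α i)
    (ν : Measure (Fin (D + 1) → ℕ)) [SFinite ν] :
    ((dirichletKernel α ×ₖ Kernel.id) ∘ₘ ν).map Prod.swap = ν ⊗ₘ dirichletKernel α := by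
  have := isMarkovKernel_dirichletKernel hα
  rw [Measure.map_comp _ _ measurable_swap, Measure.compProd_eq_comp_prod]
  congr 2
  ext1 n
  rw [Kernel.map_apply _ measurable_swap, Kernel.prod_apply, Kernel.prod_apply, Measure.prod_swap]

theorem IsCNcDirJoint.isCNcDir_map_fst {D : ℕ} {α : Fin (D + 1) → ℝ} (hα : ∀ i, 0 < α i)
    {l : Fin (D + 1) → ℝ≥0} {ρ : Measure ((Fin D → ℝ) × (Fin (D + 1) → ℕ))}
    (h : IsCNcDirJoint α l ρ) : IsCNcDir α l (ρ.map Prod.fst) := by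
  have := isProbabilityMeasure_pairLaw hα l
  rw [IsCNcDir, pi_ncChiSq_eq_map_pairLaw hα]
  exact IsCondLawAt.of_comp (by fun_prop) measurable_normalized (by fun_prop)
    (IsCondLawAt.map (by fun_prop) (by fun_prop) continuous_fst measurable_fst h)

/-- The second marginal of the joint conditional law for shapes `β` involves only `∑ β_i`, so one
measure serves every `β` of total `a`. -/
theorem isMixtureWeight_mixtureWeight {D : ℕ} {a : ℝ} (ha : 0 < a) (l : Fin (D + 1) → ℝ≥0) :
    IsMixtureWeight a l (mixtureWeight a l) := by
  refine ⟨ha, fun β hβ hsum => ?_⟩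
  have := isProbabilityMeasure_pairLaw hβ l
  have h := isCNcDirJoint_bind_mixtureWeight hβ l
  rw [hsum] at h
  have h' := IsCondLawAt.map (by fun_prop) (by fun_prop) continuous_snd measurable_snd h
  rwa [dirichletKernel_prod_id_map_snd hβ] at h'

/-- The quantifier over shape vectors is not vacuous: `α` is admissible, and uniqueness for this
single choice suffices. -/
theorem IsMixtureWeight.unique {D : ℕ} {α : Fin (D + 1) → ℝ} (hα : ∀ i, 0 < α i)
    {l : Fin (D + 1) → ℝ≥0} {ν ν' : Measure (Fin (D + 1) → ℕ)}
    (h : IsMixtureWeight (∑ i, α i) l ν) (h' : IsMixtureWeight (∑ i, α i) l ν') : ν = ν' := by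
  have := isProbabilityMeasure_pairLaw hα l
  exact IsCondLawAt.unique (h.2 α hα rfl) (h'.2 α hα rfl)

theorem IsCNcDir.unique {D : ℕ} {α : Fin (D + 1) → ℝ} (hα : ∀ i, 0 < α i)
    {l : Fin (D + 1) → ℝ≥0} {μ μ' : Measure (Fin D → ℝ)}
    (h : IsCNcDir α l μ) (h' : IsCNcDir α l μ') : μ = μ' := by
  have := isProbabilityMeasure_pairLaw hα l
  rw [IsCNcDir, pi_ncChiSq_eq_map_pairLaw hα] at h h'
  exact IsCondLawAt.unique h h'

theorem IsCNcDirJoint.unique {D : ℕ} {α : Fin (D + 1) → ℝ} (hα : ∀ i, 0 < α i)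
    {l : Fin (D + 1) → ℝ≥0} {ρ ρ' : Measure ((Fin D → ℝ) × (Fin (D + 1) → ℕ))}
    (h : IsCNcDirJoint α l ρ) (h' : IsCNcDirJoint α l ρ') : ρ = ρ' := by
  have := isProbabilityMeasure_pairLaw hα l
  exact IsCondLawAt.unique h h'

theorem mainTheorem7 {D : ℕ} (hD : 1 ≤ D) (α : Fin (D + 1) → ℝ) (hα : ∀ i, 0 < α i)
    (l : Fin (D + 1) → ℝ≥0) :
    -- the joint law of `(X'', N)`, and the laws `CNcDir^D(α, l)` and `MW^{D+1}(α⁺, l)`,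
    -- are well defined
    (∃! ρ, IsCNcDirJoint α l ρ) ∧ (∃! μ, IsCNcDir α l μ) ∧
    (∃! ν, IsMixtureWeight (∑ i, α i) l ν) ∧
    -- `X'' ~ CNcDir^D(α, l)`, `N ~ MW^{D+1}(α⁺, l)` and `X'' | N ~ Dir^D(α + N)`
    (∀ (Ω : Type*) [MeasurableSpace Ω] (P : Measure Ω) [IsProbabilityMeasure P]
      (X : Ω → Fin D → ℝ) (N : Ω → Fin (D + 1) → ℕ),
      AEMeasurable X P → AEMeasurable N P →
      IsCNcDirJoint α l (P.map fun ω => (X ω, N ω)) →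
        IsCNcDir α l (P.map X) ∧ IsMixtureWeight (∑ i, α i) l (P.map N) ∧
        ∀ᵐ n ∂(P.map N), condDistrib X N P n = dirichlet fun i => α i + n i) ∧
    -- in terms of laws: `CNcDir^D(α, l)` is the `MW^{D+1}(α⁺, l)`-mixture of the `Dir^D(α + n)`
    (∀ μ ν, IsCNcDir α l μ → IsMixtureWeight (∑ i, α i) l ν →
      μ = ν.bind fun n => dirichlet fun i => α i + n i) := by
  have hsum : 0 < ∑ i, α i := Finset.sum_pos (fun i _ => hα i) Finset.univ_nonempty
  have hMk := isMarkovKernel_dirichletKernel hα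
  have hjoint := isCNcDirJoint_bind_mixtureWeight hα l
  have hdir := hjoint.isCNcDir_map_fst hα
  have hmw := isMixtureWeight_mixtureWeight hsum l
  refine ⟨⟨_, hjoint, fun ρ h => h.unique hα hjoint⟩, ⟨_, hdir, fun μ h => h.unique hα hdir⟩,
    ⟨_, hmw, fun ν h => h.unique hα hmw⟩, fun Ω _ P _ X N hX hN h => ?_, fun μ ν hμ hν => ?_⟩
  -- Uniqueness identifies the law of `(X, N)` with the explicit mixture, from which both marginals
  -- and the disintegration along `N` are read off.
  · have hlaw := h.unique hα hjoint
    have hXmap : P.map X = (P.map fun ω => (X ω, N ω)).map Prod.fst :=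
      (AEMeasurable.map_map_of_aemeasurable measurable_fst.aemeasurable (hX.prodMk hN)).symm
    have hNmap : P.map N = mixtureWeight (∑ i, α i) l := by
      rw [← dirichletKernel_prod_id_map_snd hα (mixtureWeight _ _), ← hlaw]
      exact (AEMeasurable.map_map_of_aemeasurable measurable_snd.aemeasurable (hX.prodMk hN)).symm
    refine ⟨hXmap ▸ h.isCNcDir_map_fst hα, hNmap ▸ hmw, ?_⟩
    refine condDistrib_ae_eq_of_measure_eq_compProd N hX (κ := dirichletKernel α) ?_
    rw [← dirichletKernel_prod_id_map_swap hα, hNmap, ← hlaw]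
    exact (AEMeasurable.map_map_of_aemeasurable measurable_swap.aemeasurable (hX.prodMk hN)).symm
  · rw [hμ.unique hα hdir, hν.unique hα hmw]
    exact dirichletKernel_prod_id_map_fst hα _
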